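/- Let $K\subset\mathbb{R}^d$ be a bounded open set (in particular the interior of a coarse element, $d=2,3$), and let $\kappa\in L^\infty(K)$ with $\kappa\ge c_0>0$ almost everywhere on $K$. Put $$a^K(v,w)=\int_K\kappa\,\nabla v\cdot\nabla w\quad (v,w\in H^1(K)),\qquad m^K(v,w)=\int_K\kappa\, v\,w\quad (v,w\in L^2(K)).$$ Let $\mu_1^K\le\mu_2^K\le\cdots$ be the eigenvalues, repeated according to multiplicity, and $\{\phi_\ell^K\}_{\ell\ge1}\subset H^1_0(K)$ corresponding $m^K$-orthonormal eigenfunctions, of the Dirichlet problem $a^K(\phi,z)=\mu\, m^K(\phi,z)$ for all $z\in H^1_0(K)$ (all eigenvalues and all eigenfunctions being listed: each eigenfunction with eigenvalue $\mu$ is a linear combination of those $\phi^K_\ell$ with $\mu_\ell^K=\mu$). For $u\in L^2(K)$ let $$|||u|||_{2,K}^2=\sum_{\ell=1}^\infty(\mu_\ell^K)^2\,m^K(u,\phi_\ell^K)^2\in[0,\infty].$$ If $u\in L^2(K)$ and $|||u|||_{2,K}<\infty$, then $u\in H^1_0(K)$, the distributional divergence $\operatorname{div}(\kappa\nabla u)$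 is a function on $K$ with $\kappa^{-1}\operatorname{div}(\kappa\nabla u)\in L^2(K)$, the series $\mathcal{A}^Ku=\sum_{\ell=1}^\infty\mu_\ell^K\,m^K(u,\phi_\ell^K)\,\phi_\ell^K$ converges in $L^2(K)$, and $$\mathcal{A}^Ku=-\kappa^{-1}\operatorname{div}(\kappa\nabla u),\qquad a^K(u,v)=-\int_K\operatorname{div}(\kappa\nabla u)\,v\quad\text{for all }v\in H^1_0(K).$$ Moreover, $$|||u|||_{2,K}^2=m^K(\mathcal{A}^Ku,\mathcal{A}^Ku)=\int_K\kappa^{-1}\,|\operatorname{div}(\kappa\nabla u)|^2 .$$ -/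

import Mathlib

open MeasureTheory Filter Topology
open scoped ENNReal ContDiff

noncomputable section

namespace DirichletBlock

/-- Euclidean space `ℝ^d`. -/
abbrev E (d : ℕ) : Type := EuclideanSpace ℝ (Fin d)

/-- `L²(K)`, with Lebesgue measure. -/
abbrev L2 {d : ℕ} (K : Set (E d)) : Type :=
  Lp ℝ 2 (volume.restrict K)

/-- `L²(K; ℝ^d)`. -/
abbrev L2Vec {d : ℕ} (K : Set (E d)) : Type :=
  Lp (E d) 2 (volume.restrict K)

/-- Test functions: `ψ ∈ C_c^∞(K)`. -/
def IsTest {d : ℕ} (K : Set (E d)) (ψ : E d → ℝ) : Prop :=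
  ContDiff ℝ ∞ ψ ∧ HasCompactSupport ψ ∧ tsupport ψ ⊆ K

/-- `G ∈ L²(K; ℝ^d)` is the weak gradient of `u ∈ L²(K)`: `∫_K u ∇ψ = - ∫_K ψ G` for every
test function `ψ`. -/
def IsWeakGrad {d : ℕ} (K : Set (E d)) (u : L2 K) (G : L2Vec K) : Prop :=
  ∀ ψ : E d → ℝ, IsTest K ψ →
    ∫ x in K, u x • gradient ψ x = - ∫ x in K, ψ x • G x

/-- `u ∈ H¹(K)`. -/
def MemH1 {d : ℕ} (K : Set (E d)) (u : L2 K) : Prop :=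
  ∃ G : L2Vec K, IsWeakGrad K u G

open Classical in
/-- The weak gradient `∇u` of `u ∈ H¹(K)` (and `0` if `u ∉ H¹(K)`). -/
def weakGrad {d : ℕ} (K : Set (E d)) (u : L2 K) : L2Vec K :=
  if h : MemH1 K u then h.choose else 0

/-- `u ∈ H¹₀(K)`: the function `u` lies in the closure of `C_c^∞(K)` in `H¹(K)`. -/
def MemH10 {d : ℕ} (K : Set (E d)) (u : L2 K) : Prop :=
  MemH1 K u ∧ ∃ ψ : ℕ → E d → ℝ, (∀ n, IsTest K (ψ n)) ∧
    Tendsto (fun n => eLpNorm (fun x => u x - ψ n x) 2 (volume.restrict K)) atTop (𝓝 0) ∧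
    Tendsto (fun n => eLpNorm (fun x => weakGrad K u x - gradient (ψ n) x) 2
      (volume.restrict K)) atTop (𝓝 0)

/-- `w ∈ L¹_loc(K)` is the divergence of the vector field `F` on `K` in the sense of
distributions: `∫_K F · ∇ψ = - ∫_K w ψ` for every test function `ψ`. -/
def IsWeakDiv {d : ℕ} (K : Set (E d)) (F : E d → E d) (w : E d → ℝ) : Prop :=
  LocallyIntegrableOn w K volume ∧
    ∀ ψ : E d → ℝ, IsTest K ψ →
      ∫ x in K, inner ℝ (F x) (gradient ψ x) = - ∫ x in K, w x * ψ x

/-- The energy form `a^K(u, v) = ∫_K κ ∇u · ∇v`. -/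
def energyForm {d : ℕ} (K : Set (E d)) (κ : E d → ℝ) (u v : L2 K) : ℝ :=
  ∫ x in K, κ x * inner ℝ (weakGrad K u x) (weakGrad K v x)

/-- The mass form `m^K(u, v) = ∫_K κ u v`. -/
def massForm {d : ℕ} (K : Set (E d)) (κ : E d → ℝ) (u v : L2 K) : ℝ :=
  ∫ x in K, κ x * u x * v x

/-- `φ` is a Dirichlet eigenfunction on `K` with eigenvalue `μ`: a nonzero `φ ∈ H¹₀(K)` with
`a^K(φ, z) = μ m^K(φ, z)` for all `z ∈ H¹₀(K)`. -/
def IsEigenpair {d : ℕ} (K : Set (E d)) (κ : E d → ℝ) (μ : ℝ) (φ : L2 K) : Prop :=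
  φ ≠ 0 ∧ MemH10 K φ ∧ ∀ z : L2 K, MemH10 K z → energyForm K κ φ z = μ * massForm K κ φ z

/-- `(μ ℓ)` and `(φ ℓ)` are the Dirichlet eigenvalues on `K` and their eigenfunctions: the
eigenvalues in increasing order and repeated according to their multiplicity, the eigenfunctions
`m^K`-orthonormal.  The last field says that no eigenvalue and no eigenfunction is missing; that
the eigenfunctions are complete in `L²(K)` is not part of the definition. -/
structure IsEigensystem {d : ℕ} (K : Set (E d)) (κ : E d → ℝ) (μ : ℕ → ℝ) (φ : ℕ → L2 K) :
    Prop where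
  eigenpair : ∀ l, IsEigenpair K κ (μ l) (φ l)
  orthonormal : ∀ k l, massForm K κ (φ k) (φ l) = if k = l then 1 else 0
  ordered : Monotone μ
  exhaustive : ∀ (ν : ℝ) (ψ : L2 K), IsEigenpair K κ ν ψ →
    ψ ∈ Submodule.span ℝ (φ '' {l | μ l = ν})

/-- `|||v|||²_{s,K} = ∑ μ_ℓ^s m^K(v, φ_ℓ)²`, with values in `[0, ∞]`. -/
def eigNormSq {d : ℕ} (K : Set (E d)) (κ : E d → ℝ) (μ : ℕ → ℝ) (φ : ℕ → L2 K) (s : ℝ)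
    (v : L2 K) : ℝ≥0∞ :=
  ∑' l, ENNReal.ofReal (μ l ^ s * massForm K κ v (φ l) ^ 2)

/-- The terms of the series `A^K u = ∑ μ_ℓ m^K(u, φ_ℓ) φ_ℓ`. -/
def opTerm {d : ℕ} (K : Set (E d)) (κ : E d → ℝ) (μ : ℕ → ℝ) (φ : ℕ → L2 K) (u : L2 K)
    (l : ℕ) : L2 K :=
  (μ l * massForm K κ u (φ l)) • φ l

end DirichletBlock

end

/-!
The two forms are combined into the inner product `m^K + a^K`. With `a = √κ`, bounded above and
below, the map `u ↦ (a u, a ∇u)` identifies `H¹₀(K)` with a closed subspace `V` of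
`L²(K) × L²(K; ℝ^d)` (`weightedH10`) whose inner product is `m^K + a^K`, and the inclusion of
`H¹₀(K)` in `L²(K)` becomes `J : V → L²(K)` (`weightedEmbed`). For `f ∈ L²(K)`, the equation
`J J† f = a u` says exactly that `u ∈ H¹₀(K)` and `m^K(u, v) + a^K(u, v) = ⟪f, a v⟫` for all
`v ∈ H¹₀(K)` (`memH10_and_energyForm_of_weightedEmbed_adjoint` and
`weightedEmbed_adjoint_eq_of_energyForm`). Hence the eigenvectors of `J J†` are the functions `a φ`
with `φ` a Dirichlet eigenfunction, the eigenvalue `μ` of `φ` corresponding to `(μ + 1)⁻¹`. Adding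
`m^K` to `a^K` makes this work without the Poincaré inequality on `K`.

Completeness of the eigenfunctions (`IsEigensystem.orthogonal_span_eq_bot`) is then the spectral
theorem for `J J†`: `J` has dense range because test functions are dense, and `J` is compact by
Rellich's theorem. The latter is obtained for test functions from the translation estimate
`lintegral_enorm_sq_translate_sub_le`: averaging over the cubes of a grid of side `h` is a
finite-rank operator, and it differs from the identity by `O(h) ‖∇ψ‖` (`enorm_sub_gridAvg_sq_le`).
By density, the embedding is a norm limit of compact operators.

Thus `e_ℓ = a φ_ℓ` is a Hilbert basis of `L²(K)`. If `∑ μ_ℓ² m^K(u, φ_ℓ)²` is finite, then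
`W = ∑ μ_ℓ m^K(u, φ_ℓ) e_ℓ` converges, with squared norm equal to this sum, and
`J J† (W + a u) = a u` (`exists_hasSum_of_summable_eigenvalue_sq`). So `u ∈ H¹₀(K)`, and with
`A u = a⁻¹ W` one gets `a^K(u, v) = m^K(A u, v)` for all `v ∈ H¹₀(K)`. Testing with `C_c^∞(K)`
shows that the divergence of `κ ∇u` is `-κ A u`, from which all the identities follow.
-/

namespace DirichletBlock

/-! ### Completeness of eigenvectors of a compact embedding -/

theorem isCompactOperator_of_forall_exists_norm_sub_le {X Y : Type*}
    [NormedAddCommGroup X] [NormedSpace ℝ X] [NormedAddCommGroup Y] [NormedSpace ℝ Y]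
    [CompleteSpace Y] {J : X →L[ℝ] Y}
    (h : ∀ ε > 0, ∃ T : X →L[ℝ] Y, IsCompactOperator T ∧ ∀ x, ‖J x - T x‖ ≤ ε * ‖x‖) :
    IsCompactOperator J := by
  choose T hT hest using fun n : ℕ => h (1 / (n + 1)) Nat.one_div_pos_of_nat
  refine isCompactOperator_of_tendsto (F := T) (l := atTop) ?_ (Eventually.of_forall hT)
  rw [tendsto_iff_norm_sub_tendsto_zero]
  refine squeeze_zero (fun _ => norm_nonneg _) (fun n => ?_) tendsto_one_div_add_atTop_nhds_zero_nat
  rw [norm_sub_rev]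
  exact ContinuousLinearMap.opNorm_le_bound _ (by positivity) (hest n)

/-- For a compact `J` with dense range, the eigenvectors of the positive operator `J J†` with nonzero
eigenvalue span a dense subspace: this is the spectral theorem for `J J†`, which is injective since
`J` has dense range. The density is `hdense`, and `S` is any subspace containing the
eigenvectors. -/
theorem orthogonal_eq_bot_of_eigenvectors_mem {V H : Type*}
    [NormedAddCommGroup V] [InnerProductSpace ℝ V] [CompleteSpace V]
    [NormedAddCommGroup H] [InnerProductSpace ℝ H] [CompleteSpace H]
    (J : V →L[ℝ] H) (hJ : IsCompactOperator J)
    (hdense : ∀ f : H, (∀ z, inner ℝ f (J z) = 0) → f = 0)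
    (S : Submodule ℝ H)
    (hS : ∀ (f : H) (r : ℝ), f ≠ 0 → r ≠ 0 → J (J.adjoint f) = r • f → f ∈ S) :
    Sᗮ = ⊥ := by
  have hT : IsCompactOperator (J ∘L J.adjoint) := hJ.comp_clm J.adjoint
  have hsymm : (J ∘L J.adjoint).IsSymmetric := by
    intro x y
    change inner ℝ (J (J.adjoint x)) y = inner ℝ x (J (J.adjoint y))
    rw [← J.adjoint_inner_right, J.adjoint_inner_left]
  have hsup := ContinuousLinearMap.orthogonalComplement_iSup_eigenspaces_eq_bot hT hsymm
  rw [eq_bot_iff, ← hsup]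
  apply Submodule.orthogonal_le
  refine iSup_le fun r f hf => ?_
  rw [Module.End.mem_eigenspace_iff] at hf
  change J (J.adjoint f) = r • f at hf
  by_cases hf0 : f = 0
  · simp [hf0]
  refine hS f r hf0 ?_ hf
  rintro rfl
  apply hf0
  rw [zero_smul] at hf
  -- `‖J† f‖² = ⟪f, J J† f⟫ = 0`, so `f` is orthogonal to the range of `J`.
  have h0 : J.adjoint f = 0 := by
    rw [← inner_self_eq_zero (𝕜 := ℝ), J.adjoint_inner_left, hf, inner_zero_right]
  exact hdense f fun z => by rw [← J.adjoint_inner_left, h0, inner_zero_left]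

/-- If `J J†` acts on an orthonormal basis `e` as `e l ↦ (μ l + 1)⁻¹ • e l`, then every `U` for which
`∑ μ l ⟪e l, U⟫ e l` converges lies in the range of `J J†`. -/
theorem exists_hasSum_of_summable_eigenvalue_sq {V H : Type*}
    [NormedAddCommGroup V] [InnerProductSpace ℝ V] [CompleteSpace V]
    [NormedAddCommGroup H] [InnerProductSpace ℝ H] [CompleteSpace H]
    (J : V →L[ℝ] H) {e : ℕ → H} (he : Orthonormal ℝ e)
    (htop : (Submodule.span ℝ (Set.range e))ᗮ = ⊥) {μ : ℕ → ℝ}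
    (hμ : ∀ l, (μ l + 1) • J (J.adjoint (e l)) = e l) {U : H}
    (hU : Summable fun l => (μ l * inner ℝ (e l) U) ^ 2) :
    ∃ W : H, HasSum (fun l => (μ l * inner ℝ (e l) U) • e l) W ∧
      HasSum (fun l => (μ l * inner ℝ (e l) U) ^ 2) (‖W‖ ^ 2) ∧ J (J.adjoint (W + U)) = U := by
  let B : HilbertBasis ℕ ℝ H := HilbertBasis.mkOfOrthogonalEqBot he htop
  have hB : ⇑B = e := HilbertBasis.coe_mkOfOrthogonalEqBot he htop
  have hmem : Memℓp (fun l => μ l * inner ℝ (e l) U) 2 := by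
    rw [memℓp_gen_iff (by norm_num)]
    simpa [← sq_abs (μ _ * _), abs_mul] using hU
  let W : H := B.repr.symm ⟨_, hmem⟩
  have hW : HasSum (fun l => (μ l * inner ℝ (e l) U) • e l) W := by
    simpa [hB] using B.hasSum_repr_symm ⟨_, hmem⟩
  have hsumU : HasSum (fun l => (inner ℝ (e l) U) • e l) U := by
    simpa [hB, B.repr_apply_apply] using B.hasSum_repr U
  refine ⟨W, hW, ?_, ?_⟩
  · have h := lp.hasSum_norm (by norm_num) (⟨_, hmem⟩ : lp (fun _ : ℕ => ℝ) 2)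
    have hn : ‖W‖ = ‖(⟨_, hmem⟩ : lp (fun _ : ℕ => ℝ) 2)‖ := B.repr.symm.norm_map _
    rw [hn]
    simpa [← sq_abs (μ _ * _), abs_mul] using h
  · have h1 := (J ∘L J.adjoint).hasSum (hW.add hsumU)
    refine h1.unique ?_
    convert! hsumU using 2 with l
    rw [← add_smul, map_smul, ContinuousLinearMap.comp_apply, ← add_one_mul, mul_comm, mul_smul,
      hμ l]

/-! ### Multiplication operators on `L²` -/

section MulOp

variable {α F : Type*} {mα : MeasurableSpace α} {ν : Measure α}
  [NormedAddCommGroup F] [NormedSpace ℝ F] {a b : α → ℝ}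

/-- Multiplication by an essentially bounded function `a`, as a bounded operator on `L²`. -/
noncomputable def mulOp (F : Type*) [NormedAddCommGroup F] [NormedSpace ℝ F]
    (ha : MemLp a ⊤ ν) : Lp F 2 ν →L[ℝ] Lp F 2 ν :=
  (ContinuousLinearMap.lsmul ℝ ℝ : ℝ →L[ℝ] F →L[ℝ] F).holderL ν ⊤ 2 2 (ha.toLp a)

theorem coeFn_mulOp (ha : MemLp a ⊤ ν) (f : Lp F 2 ν) :
    mulOp F ha f =ᵐ[ν] fun x => a x • f x := by
  have h := (ContinuousLinearMap.lsmul ℝ ℝ : ℝ →L[ℝ] F →L[ℝ] F).coeFn_holder (r := 2)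
    (ha.toLp a) f
  filter_upwards [h, ha.coeFn_toLp] with x hx hx'
  rw [mulOp, ContinuousLinearMap.holderL_apply_apply, hx, hx']
  rfl

theorem mulOp_mulOp_of_mul_eq_one (ha : MemLp a ⊤ ν) (hb : MemLp b ⊤ ν)
    (hab : ∀ᵐ x ∂ν, a x * b x = 1) (f : Lp F 2 ν) : mulOp F ha (mulOp F hb f) = f := by
  apply Lp.ext
  filter_upwards [coeFn_mulOp ha (mulOp F hb f), coeFn_mulOp hb f, hab] with x h1 h2 h3
  rw [h1, h2, smul_smul, h3, one_smul]

theorem inner_mulOp_mulOp {F : Type*} [NormedAddCommGroup F] [InnerProductSpace ℝ F]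
    (ha : MemLp a ⊤ ν) {κ : α → ℝ} (hκ : ∀ᵐ x ∂ν, a x * a x = κ x) (f g : Lp F 2 ν) :
    inner ℝ (mulOp F ha f) (mulOp F ha g) = ∫ x, κ x * inner ℝ (f x) (g x) ∂ν := by
  rw [L2.inner_def]
  apply integral_congr_ae
  filter_upwards [coeFn_mulOp ha f, coeFn_mulOp ha g, hκ] with x h1 h2 h3
  rw [h1, h2, real_inner_smul_left, real_inner_smul_right, ← mul_assoc, h3]

end MulOp

/-! ### The translation estimate -/

theorem continuous_gradient {d : ℕ} {ψ : E d → ℝ} (h : ContDiff ℝ 1 ψ) :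
    Continuous (gradient ψ) := by
  unfold gradient
  exact (LinearIsometryEquiv.continuous _).comp (h.continuous_fderiv one_ne_zero)

/-- The Cauchy–Schwarz inequality against the constant function `1`. -/
theorem sq_lintegral_le {α : Type*} {mα : MeasurableSpace α} {ν : Measure α} {f : α → ℝ≥0∞}
    (hf : AEMeasurable f ν) : (∫⁻ x, f x ∂ν) ^ 2 ≤ ν Set.univ * ∫⁻ x, f x ^ 2 ∂ν := by
  have h := ENNReal.lintegral_mul_le_Lp_mul_Lq ν Real.HolderConjugate.two_two hf
    (aemeasurable_const (b := (1 : ℝ≥0∞)))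
  have h2 := pow_le_pow_left' h 2
  rw [mul_pow, ← ENNReal.rpow_natCast, ← ENNReal.rpow_natCast (_ ^ (1 / 2 : ℝ)),
    ← ENNReal.rpow_natCast (_ ^ (1 / 2 : ℝ)), ← ENNReal.rpow_mul, ← ENNReal.rpow_mul] at h2
  norm_num at h2
  simpa [mul_comm] using h2

/-- A translation by `z` moves `ψ` in `L²` by at most `‖z‖ ‖∇ψ‖`: write the difference as the integral
of the derivative along the segment from `x` to `x + z`, and use Cauchy–Schwarz and Tonelli. -/
theorem lintegral_enorm_sq_translate_sub_le {d : ℕ} {ψ : E d → ℝ} (h : ContDiff ℝ 1 ψ) (z : E d) :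
    ∫⁻ x, ‖ψ (x + z) - ψ x‖ₑ ^ 2 ≤ ‖z‖ₑ ^ 2 * ∫⁻ x, ‖gradient ψ x‖ₑ ^ 2 := by
  have hgc := continuous_gradient h
  have hm : ∀ x, Measurable fun t : ℝ => ‖gradient ψ (x + t • z)‖ₑ := fun x =>
    (hgc.comp (by fun_prop : Continuous fun t : ℝ => x + t • z)).enorm.measurable
  have hpt : ∀ x, ‖ψ (x + z) - ψ x‖ₑ ^ 2 ≤
      ‖z‖ₑ ^ 2 * ∫⁻ t in Set.Ioc (0 : ℝ) 1, ‖gradient ψ (x + t • z)‖ₑ ^ 2 := by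
    intro x
    have hd : ∀ t ∈ Set.uIcc (0 : ℝ) 1,
        HasDerivAt (fun t : ℝ => ψ (x + t • z)) (inner ℝ (gradient ψ (x + t • z)) z) t := by
      intro t _
      have h1 : HasDerivAt (fun t : ℝ => x + t • z) z t := by
        simpa using ((hasDerivAt_id t).smul_const z).const_add x
      have h2 := ((h.differentiable one_ne_zero) (x + t • z)).hasFDerivAt.comp_hasDerivAt t h1
      rwa [← inner_gradient_left] at h2
    have hcont : Continuous fun t : ℝ => inner ℝ (gradient ψ (x + t • z)) z := by fun_prop
    have hft := intervalIntegral.integral_eq_sub_of_hasDerivAt hd (hcont.intervalIntegrable 0 1)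
    simp only [one_smul, zero_smul, add_zero] at hft
    rw [← hft, intervalIntegral.integral_of_le zero_le_one]
    have hb : ‖∫ t in Set.Ioc (0 : ℝ) 1, inner ℝ (gradient ψ (x + t • z)) z‖ₑ ≤
        ‖z‖ₑ * ∫⁻ t in Set.Ioc (0 : ℝ) 1, ‖gradient ψ (x + t • z)‖ₑ := by
      refine (enorm_integral_le_lintegral_enorm _).trans ?_
      rw [← lintegral_const_mul _ (hm x)]
      refine lintegral_mono fun t => ?_
      rw [mul_comm, ← ofReal_norm, ← ofReal_norm, ← ofReal_norm,
        ← ENNReal.ofReal_mul (norm_nonneg _)]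
      exact ENNReal.ofReal_le_ofReal (norm_inner_le_norm _ _)
    refine (pow_le_pow_left' hb 2).trans ?_
    rw [mul_pow]
    gcongr
    simpa using sq_lintegral_le (hm x).aemeasurable (ν := volume.restrict (Set.Ioc (0 : ℝ) 1))
  calc ∫⁻ x, ‖ψ (x + z) - ψ x‖ₑ ^ 2
      ≤ ∫⁻ x, ‖z‖ₑ ^ 2 * ∫⁻ t in Set.Ioc (0 : ℝ) 1, ‖gradient ψ (x + t • z)‖ₑ ^ 2 :=
        lintegral_mono hpt
    _ = ‖z‖ₑ ^ 2 * ∫⁻ x, ∫⁻ t in Set.Ioc (0 : ℝ) 1, ‖gradient ψ (x + t • z)‖ₑ ^ 2 :=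
        lintegral_const_mul' _ _ (by finiteness)
    _ = ‖z‖ₑ ^ 2 * ∫⁻ t in Set.Ioc (0 : ℝ) 1, ∫⁻ x, ‖gradient ψ (x + t • z)‖ₑ ^ 2 := by
        rw [lintegral_lintegral_swap]
        exact Continuous.aemeasurable (by fun_prop)
    _ = ‖z‖ₑ ^ 2 * ∫⁻ x, ‖gradient ψ x‖ₑ ^ 2 := by
        congr 1
        simp_rw [lintegral_add_right_eq_self (fun x => ‖gradient ψ x‖ₑ ^ 2)]
        simp

/-! ### Averages over the cubes of a grid -/

/-- The half-open cube of side `h` with lower corner `h • k`. -/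
def gridCube {d : ℕ} (h : ℝ) (k : Fin d → ℤ) : Set (E d) :=
  {x | ∀ i, x i ∈ Set.Ico (h * k i) (h * (k i + 1))}

theorem gridCube_eq_preimage {d : ℕ} (h : ℝ) (k : Fin d → ℤ) :
    gridCube h k = (WithLp.ofLp : E d → Fin d → ℝ) ⁻¹'
      Set.univ.pi fun i => Set.Ico (h * k i) (h * (k i + 1)) := by
  ext x; simp [gridCube]

theorem measurableSet_gridCube {d : ℕ} (h : ℝ) (k : Fin d → ℤ) :
    MeasurableSet (gridCube (d := d) h k) := by
  rw [gridCube_eq_preimage]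
  exact (PiLp.volume_preserving_ofLp (Fin d)).measurable
    (MeasurableSet.univ_pi fun i => measurableSet_Ico)

theorem volume_gridCube {d : ℕ} (h : ℝ) (k : Fin d → ℤ) :
    volume (gridCube (d := d) h k) = ENNReal.ofReal h ^ d := by
  rw [gridCube_eq_preimage, (PiLp.volume_preserving_ofLp (Fin d)).measure_preimage
    (MeasurableSet.univ_pi fun i => measurableSet_Ico).nullMeasurableSet, Real.volume_pi_Ico]
  simp [mul_add]

theorem mem_gridCube_iff {d : ℕ} {h : ℝ} (hh : 0 < h) (k : Fin d → ℤ) (x : E d) :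
    x ∈ gridCube h k ↔ (fun i => ⌊x i / h⌋) = k := by
  simp only [gridCube, Set.mem_ofPred_eq, Set.mem_Ico, funext_iff, Int.floor_eq_iff]
  refine forall_congr' fun i => ?_
  rw [le_div_iff₀ hh, div_lt_iff₀ hh, mul_comm h, mul_comm h]

theorem norm_sub_le_of_mem_gridCube {d : ℕ} {h : ℝ} (hh : 0 < h) {k : Fin d → ℤ} {x y : E d}
    (hx : x ∈ gridCube h k) (hy : y ∈ gridCube h k) : ‖y - x‖ ≤ h * √d := by
  rw [EuclideanSpace.norm_eq, Real.sqrt_le_left (by positivity), mul_pow, Real.sq_sqrt (by simp)]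
  calc ∑ i, ‖(y - x) i‖ ^ 2 ≤ ∑ _i : Fin d, h ^ 2 := by
        refine Finset.sum_le_sum fun i _ => ?_
        have h1 := hx i
        have h2 := hy i
        simp only [Set.mem_Ico] at h1 h2
        refine pow_le_pow_left₀ (norm_nonneg _) ?_ 2
        rw [PiLp.sub_apply, Real.norm_eq_abs, abs_le]
        constructor <;> linarith
    _ = h ^ 2 * d := by simp [mul_comm]

theorem exists_finset_gridCube {d : ℕ} {K : Set (E d)} (hKb : Bornology.IsBounded K) {h : ℝ}
    (hh : 0 < h) : ∃ I : Finset (Fin d → ℤ), ∀ x ∈ K, (fun i => ⌊x i / h⌋) ∈ I := by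
  obtain ⟨R, hR⟩ := hKb.exists_norm_le
  refine ⟨Fintype.piFinset fun _ => Finset.Icc ⌊-R / h⌋ ⌊R / h⌋, fun x hx => ?_⟩
  rw [Fintype.mem_piFinset]
  intro i
  have hi : |x i| ≤ R := (PiLp.norm_apply_le x i).trans (hR x hx)
  rw [abs_le] at hi
  rw [Finset.mem_Icc]
  constructor <;> apply Int.floor_le_floor <;> gcongr <;> linarith

/-- On a cube of the grid, the deviation of `ψ` from its average is controlled by the differences
of `ψ` over translations of length at most the diameter of the cube. -/
theorem enorm_sub_average_sq_le {d : ℕ} {ψ : E d → ℝ} (hψ : Continuous ψ)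
    (hψc : HasCompactSupport ψ) {h : ℝ} (hh : 0 < h) {k : Fin d → ℤ} {x : E d}
    (hx : x ∈ gridCube h k) :
    ‖ψ x - (h ^ d)⁻¹ * ∫ y in gridCube h k, ψ y‖ₑ ^ 2 ≤
      ENNReal.ofReal (h ^ d)⁻¹ *
        ∫⁻ z in Metric.closedBall 0 (h * √d), ‖ψ (x + z) - ψ x‖ₑ ^ 2 := by
  set Q := gridCube (d := d) h k with hQ
  have hQm : MeasurableSet Q := measurableSet_gridCube h k
  have hQv : volume Q = ENNReal.ofReal (h ^ d) := by
    rw [hQ, volume_gridCube, ENNReal.ofReal_pow hh.le]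
  have hQr : volume.real Q = h ^ d := by
    rw [measureReal_def, hQv, ENNReal.toReal_ofReal (by positivity)]
  have hint : Integrable ψ (volume.restrict Q) := (hψ.integrable_of_hasCompactSupport hψc).restrict
  have : IsFiniteMeasure (volume.restrict Q) := ⟨by simp [hQv]⟩
  have heq : ψ x - (h ^ d)⁻¹ * ∫ y in Q, ψ y = (h ^ d)⁻¹ * ∫ y in Q, (ψ x - ψ y) := by
    rw [integral_sub (integrable_const _) hint]
    simp only [integral_const, measureReal_restrict_apply_univ, hQr, smul_eq_mul]
    field_simp
  have hinv : ENNReal.ofReal (h ^ d)⁻¹ * ENNReal.ofReal (h ^ d) = 1 := by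
    rw [← ENNReal.ofReal_mul (by positivity), inv_mul_cancel₀ (by positivity), ENNReal.ofReal_one]
  calc ‖ψ x - (h ^ d)⁻¹ * ∫ y in Q, ψ y‖ₑ ^ 2
      ≤ (ENNReal.ofReal (h ^ d)⁻¹ * ∫⁻ y in Q, ‖ψ y - ψ x‖ₑ) ^ 2 := by
        rw [heq, enorm_mul, Real.enorm_of_nonneg (by positivity)]
        gcongr
        refine (enorm_integral_le_lintegral_enorm _).trans (lintegral_mono fun y => ?_)
        rw [← enorm_neg, neg_sub]
    _ ≤ ENNReal.ofReal (h ^ d)⁻¹ ^ 2 *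
          (ENNReal.ofReal (h ^ d) * ∫⁻ y in Q, ‖ψ y - ψ x‖ₑ ^ 2) := by
        rw [mul_pow]
        gcongr
        have := sq_lintegral_le (ν := volume.restrict Q) (f := fun y => ‖ψ y - ψ x‖ₑ)
          (Continuous.aemeasurable (by fun_prop))
        simpa [hQv] using this
    _ = ENNReal.ofReal (h ^ d)⁻¹ * ∫⁻ y in Q, ‖ψ y - ψ x‖ₑ ^ 2 := by
        rw [sq, mul_assoc, ← mul_assoc (ENNReal.ofReal (h ^ d)⁻¹) (ENNReal.ofReal (h ^ d)), hinv,
          one_mul]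
    _ ≤ _ := by
        refine mul_le_mul' le_rfl ?_
        rw [← lintegral_indicator hQm, ← lintegral_indicator Metric.isClosed_closedBall.measurableSet,
          ← lintegral_add_left_eq_self _ x]
        refine lintegral_mono fun z => ?_
        refine Set.indicator_apply_le' (fun hz => ?_) fun _ => zero_le
        have hz' : z ∈ Metric.closedBall (0 : E d) (h * √d) := by
          rw [mem_closedBall_zero_iff]
          simpa using norm_sub_le_of_mem_gridCube hh hx hz
        rw [Set.indicator_of_mem hz']

theorem enorm_sq_eq_lintegral {α F : Type*} {mα : MeasurableSpace α} {ν : Measure α}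
    [NormedAddCommGroup F] (f : Lp F 2 ν) : ‖f‖ₑ ^ 2 = ∫⁻ x, ‖f x‖ₑ ^ 2 ∂ν := by
  have h := eLpNorm_nnreal_pow_eq_lintegral (μ := ν) (f := f) (p := 2) (by norm_num)
  rw [Lp.enorm_def]
  simpa using h

section GridAverage

variable {d : ℕ} {K : Set (E d)}

/-- The indicator function of a grid cube, as an element of `L²(K)`. -/
noncomputable def gridInd (K : Set (E d)) (h : ℝ) (k : Fin d → ℤ) : L2 K :=
  indicatorConstLp 2 (measurableSet_gridCube h k)
    (((Measure.restrict_apply_le _ _).trans_lt (by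
      rw [volume_gridCube]; finiteness)).ne) (1 : ℝ)

/-- The finite-rank operator replacing a function by its averages over the grid cubes with index
in `I`. -/
noncomputable def gridAvg (K : Set (E d)) (h : ℝ) (I : Finset (Fin d → ℤ)) : L2 K →L[ℝ] L2 K :=
  ∑ k ∈ I, (h ^ d)⁻¹ • (innerSL ℝ (gridInd K h k)).smulRight (gridInd K h k)

theorem isCompactOperator_gridAvg (h : ℝ) (I : Finset (Fin d → ℤ)) :
    IsCompactOperator (gridAvg K h I) := by
  have : gridAvg K h I ∈ compactOperator (RingHom.id ℝ) (L2 K) (L2 K) := by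
    refine Submodule.sum_mem _ fun k _ => Submodule.smul_mem _ _ ?_
    change IsCompactOperator
      ((ContinuousLinearMap.toSpanSingleton ℝ (gridInd K h k)) ∘ (innerSL ℝ (gridInd K h k)))
    have hc : IsCompactOperator (ContinuousLinearMap.toSpanSingleton ℝ (gridInd K h k)) := by
      exact isCompactOperator_of_locallyCompactSpace_rng _
    exact hc.comp_clm _
  exact this

/-- On `K` the operator `gridAvg` averages over the cube containing the point. The average extends
the function by zero outside `K`, as the whole volume `h ^ d` of the cube is used. -/
theorem coeFn_gridAvg {h : ℝ} (hh : 0 < h) {I : Finset (Fin d → ℤ)}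
    (hI : ∀ x ∈ K, (fun i => ⌊x i / h⌋) ∈ I) (hK : MeasurableSet K) (u : L2 K) :
    ∀ᵐ x ∂volume.restrict K, gridAvg K h I u x =
      (h ^ d)⁻¹ * ∫ y in gridCube h (fun i => ⌊x i / h⌋), u y ∂volume.restrict K := by
  have hval : gridAvg K h I u =
      ∑ k ∈ I, ((h ^ d)⁻¹ * ∫ y in gridCube h k, u y ∂volume.restrict K) • gridInd K h k := by
    simp only [gridAvg, sum_apply, smul_apply,
      ContinuousLinearMap.smulRight_apply, innerSL_apply_apply, smul_smul]
    refine Finset.sum_congr rfl fun k _ => ?_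
    rw [gridInd, L2.inner_indicatorConstLp_one]
  have hind : ∀ᵐ x ∂volume.restrict K, ∀ k ∈ I,
      gridInd K h k x = (gridCube h k).indicator (fun _ => (1 : ℝ)) x :=
    (Finset.eventually_all I).2 fun k _ => indicatorConstLp_coeFn
  have hsum : ∀ᵐ x ∂volume.restrict K, gridAvg K h I u x =
      ∑ k ∈ I, ((h ^ d)⁻¹ * ∫ y in gridCube h k, u y ∂volume.restrict K) * gridInd K h k x := by
    rw [hval]
    have h1 := Lp.coeFn_fun_finsetSum I fun k =>
      ((h ^ d)⁻¹ * ∫ y in gridCube h k, u y ∂volume.restrict K) • gridInd K h k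
    have h2 : ∀ᵐ x ∂volume.restrict K, ∀ k ∈ I,
        (((h ^ d)⁻¹ * ∫ y in gridCube h k, u y ∂volume.restrict K) • gridInd K h k : L2 K) x =
        ((h ^ d)⁻¹ * ∫ y in gridCube h k, u y ∂volume.restrict K) * gridInd K h k x :=
      (Finset.eventually_all I).2 fun k _ => Lp.coeFn_smul _ _
    filter_upwards [h1, h2] with x hx1 hx2
    rw [hx1]
    exact Finset.sum_congr rfl hx2
  filter_upwards [hsum, hind, ae_restrict_mem hK] with x hx1 hx2 hxK
  rw [hx1, Finset.sum_eq_single_of_mem _ (hI x hxK)]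
  · rw [hx2 _ (hI x hxK), Set.indicator_of_mem ((mem_gridCube_iff hh _ _).2 rfl), mul_one]
  · intro k hk hne
    rw [hx2 k hk, Set.indicator_of_notMem, mul_zero]
    rw [mem_gridCube_iff hh]
    exact fun h' => hne h'.symm

/-! ### Rellich's theorem for test functions -/

theorem IsTest.eq_zero_of_notMem {ψ : E d → ℝ} (hψ : IsTest K ψ) {x : E d} (hx : x ∉ K) :
    ψ x = 0 :=
  image_eq_zero_of_notMem_tsupport fun h => hx (hψ.2.2 h)

theorem tsupport_gradient_subset (ψ : E d → ℝ) : tsupport (gradient ψ) ⊆ tsupport ψ := by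
  refine (closure_mono ?_).trans (tsupport_fderiv_subset ℝ (f := ψ))
  intro x hx
  simpa [gradient] using hx

theorem IsTest.gradient_eq_zero_of_notMem {ψ : E d → ℝ} (hψ : IsTest K ψ) {x : E d}
    (hx : x ∉ K) : gradient ψ x = 0 :=
  image_eq_zero_of_notMem_tsupport fun h => hx (hψ.2.2 (tsupport_gradient_subset ψ h))

theorem IsTest.contDiff_one {ψ : E d → ℝ} (hψ : IsTest K ψ) : ContDiff ℝ 1 ψ :=
  hψ.1.of_le (by exact_mod_cast le_top)

/-- The Poincaré inequality on the grid cubes, summed over the cubes. The deviation from the average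
is bounded by translation differences over lengths at most `h √d`; the volume of that ball of
translations and that of a cube both scale as `h ^ d`, so the bound is of order `h²`. -/
theorem enorm_sub_gridAvg_sq_le (hK : MeasurableSet K) {h : ℝ} (hh : 0 < h)
    {I : Finset (Fin d → ℤ)} (hI : ∀ x ∈ K, (fun i => ⌊x i / h⌋) ∈ I)
    {ψ : E d → ℝ} (hψ : IsTest K ψ) {u : L2 K} {G : L2Vec K}
    (hu : u =ᵐ[volume.restrict K] ψ) (hG : G =ᵐ[volume.restrict K] gradient ψ) :
    ‖u - gridAvg K h I u‖ₑ ^ 2 ≤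
      volume (Metric.closedBall (0 : E d) √d) * ENNReal.ofReal (h * √d) ^ 2 * ‖G‖ₑ ^ 2 := by
  have hGn : ‖G‖ₑ ^ 2 = ∫⁻ x, ‖gradient ψ x‖ₑ ^ 2 := by
    rw [enorm_sq_eq_lintegral,
      ← setLIntegral_eq_of_support_subset (s := K) (f := fun x => ‖gradient ψ x‖ₑ ^ 2)]
    · refine lintegral_congr_ae ?_
      filter_upwards [hG] with x hx
      rw [hx]
    · intro x hx
      by_contra hxK
      simp [hψ.gradient_eq_zero_of_notMem hxK] at hx
  have hcont : Continuous ψ := hψ.1.continuous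
  have havg : ∀ k, ∫ y in gridCube h k, u y ∂volume.restrict K = ∫ y in gridCube h k, ψ y := by
    intro k
    rw [setIntegral_congr_ae (g := ψ) (measurableSet_gridCube h k) (hu.mono fun x hx _ => hx),
      Measure.restrict_restrict (measurableSet_gridCube h k), Set.inter_comm,
      ← Measure.restrict_restrict hK]
    exact setIntegral_eq_integral_of_forall_compl_eq_zero fun x hx => hψ.eq_zero_of_notMem hx
  have hball : volume (Metric.closedBall (0 : E d) (h * √d)) =
      ENNReal.ofReal (h ^ d) * volume (Metric.closedBall (0 : E d) √d) := by
    rw [Measure.addHaar_closedBall_mul _ _ hh.le (by positivity), finrank_euclideanSpace,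
      Fintype.card_fin]
  rw [enorm_sq_eq_lintegral]
  calc ∫⁻ x in K, ‖(u - gridAvg K h I u : L2 K) x‖ₑ ^ 2
      ≤ ∫⁻ x in K, ENNReal.ofReal (h ^ d)⁻¹ *
          ∫⁻ z in Metric.closedBall 0 (h * √d), ‖ψ (x + z) - ψ x‖ₑ ^ 2 := by
        refine lintegral_mono_ae ?_
        filter_upwards [Lp.coeFn_sub u (gridAvg K h I u), hu, coeFn_gridAvg hh hI hK u]
          with x h1 h2 h3
        rw [h1, Pi.sub_apply, h2, h3, havg]
        exact enorm_sub_average_sq_le hcont hψ.2.1 hh ((mem_gridCube_iff hh _ _).2 rfl)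
    _ ≤ ∫⁻ x, ENNReal.ofReal (h ^ d)⁻¹ *
          ∫⁻ z in Metric.closedBall 0 (h * √d), ‖ψ (x + z) - ψ x‖ₑ ^ 2 :=
        setLIntegral_le_lintegral _ _
    _ = ENNReal.ofReal (h ^ d)⁻¹ *
          ∫⁻ z in Metric.closedBall 0 (h * √d), ∫⁻ x, ‖ψ (x + z) - ψ x‖ₑ ^ 2 := by
        rw [lintegral_const_mul' _ _ ENNReal.ofReal_ne_top, lintegral_lintegral_swap]
        exact Continuous.aemeasurable (by fun_prop)
    _ ≤ ENNReal.ofReal (h ^ d)⁻¹ * ∫⁻ z in Metric.closedBall (0 : E d) (h * √d),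
          ENNReal.ofReal (h * √d) ^ 2 * ∫⁻ x, ‖gradient ψ x‖ₑ ^ 2 := by
        refine mul_le_mul' le_rfl (setLIntegral_mono measurable_const fun z hz => ?_)
        refine (lintegral_enorm_sq_translate_sub_le hψ.contDiff_one z).trans ?_
        gcongr
        rw [← ofReal_norm]
        exact ENNReal.ofReal_le_ofReal (mem_closedBall_zero_iff.1 hz)
    _ = _ := by
        rw [setLIntegral_const, hball, hGn]
        have hinv : ENNReal.ofReal (h ^ d)⁻¹ * ENNReal.ofReal (h ^ d) = 1 := by
          rw [← ENNReal.ofReal_mul (by positivity), inv_mul_cancel₀ (by positivity),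
            ENNReal.ofReal_one]
        calc _ = (ENNReal.ofReal (h ^ d)⁻¹ * ENNReal.ofReal (h ^ d)) *
              (volume (Metric.closedBall (0 : E d) √d) * ENNReal.ofReal (h * √d) ^ 2 *
                ∫⁻ x, ‖gradient ψ x‖ₑ ^ 2) := by ring
          _ = _ := by rw [hinv, one_mul]

/-- On test functions the embedding of `H¹₀(K)` into `L²(K)` is approximated by compact (in fact
finite-rank) operators. -/
theorem exists_isCompactOperator_norm_sub_le (hK : MeasurableSet K)
    (hKb : Bornology.IsBounded K) {ε : ℝ} (hε : 0 < ε) :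
    ∃ P : L2 K →L[ℝ] L2 K, IsCompactOperator P ∧ ∀ (ψ : E d → ℝ) (u : L2 K) (G : L2Vec K),
      IsTest K ψ → u =ᵐ[volume.restrict K] ψ → G =ᵐ[volume.restrict K] gradient ψ →
      ‖u - P u‖ ≤ ε * ‖G‖ := by
  set C : ℝ := volume.real (Metric.closedBall (0 : E d) √d) with hC
  have hC0 : 0 ≤ C := measureReal_nonneg
  -- the side of the grid is chosen so that `C (h √d)² ≤ ε²`
  set h : ℝ := ε / √((C + 1) * (d + 1)) with hh
  have hpos : 0 < h := by positivity
  obtain ⟨I, hI⟩ := exists_finset_gridCube hKb hpos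
  refine ⟨gridAvg K h I, isCompactOperator_gridAvg h I, fun ψ u G hψ hu hG => ?_⟩
  have hmain := enorm_sub_gridAvg_sq_le hK hpos hI hψ hu hG
  have hCe : volume (Metric.closedBall (0 : E d) √d) = ENNReal.ofReal C := by
    rw [hC, ofReal_measureReal measure_closedBall_lt_top.ne]
  rw [hCe, ← ofReal_norm, ← ofReal_norm, ← ENNReal.ofReal_pow (by positivity),
    ← ENNReal.ofReal_pow (by positivity), ← ENNReal.ofReal_pow (by positivity),
    ← ENNReal.ofReal_mul hC0, ← ENNReal.ofReal_mul (by positivity),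
    ENNReal.ofReal_le_ofReal_iff (by positivity)] at hmain
  have hle : C * (h * √d) ^ 2 ≤ ε ^ 2 := by
    rw [mul_pow, Real.sq_sqrt (by positivity), hh, div_pow, Real.sq_sqrt (by positivity)]
    rw [div_mul_eq_mul_div, mul_div_assoc', div_le_iff₀ (by positivity)]
    have : 0 ≤ ε ^ 2 * (C + d + 1) := by positivity
    nlinarith
  refine le_of_sq_le_sq ?_ (by positivity)
  rw [mul_pow]
  exact hmain.trans (by gcongr)

end GridAverage

variable {d : ℕ} {K : Set (E d)}

/-! ### Weak gradients -/

theorem IsTest.continuous_gradient {ψ : E d → ℝ} (hψ : IsTest K ψ) : Continuous (gradient ψ) :=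
  DirichletBlock.continuous_gradient hψ.contDiff_one

theorem IsTest.hasCompactSupport_gradient {ψ : E d → ℝ} (hψ : IsTest K ψ) :
    HasCompactSupport (gradient ψ) :=
  hψ.2.1.of_isClosed_subset (isClosed_tsupport _) (tsupport_gradient_subset ψ)

theorem IsTest.memLp {ψ : E d → ℝ} (hψ : IsTest K ψ) : MemLp ψ 2 (volume.restrict K) :=
  (hψ.1.continuous.memLp_of_hasCompactSupport hψ.2.1).restrict K

theorem IsTest.memLp_gradient {ψ : E d → ℝ} (hψ : IsTest K ψ) :
    MemLp (gradient ψ) 2 (volume.restrict K) :=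
  (hψ.continuous_gradient.memLp_of_hasCompactSupport hψ.hasCompactSupport_gradient).restrict K

theorem isTest_zero : IsTest K (0 : E d → ℝ) :=
  ⟨contDiff_const, HasCompactSupport.zero, by simp [tsupport]⟩

theorem IsTest.add {ψ η : E d → ℝ} (hψ : IsTest K ψ) (hη : IsTest K η) : IsTest K (ψ + η) :=
  ⟨hψ.1.add hη.1, hψ.2.1.add hη.2.1,
    (tsupport_add ψ η).trans (Set.union_subset hψ.2.2 hη.2.2)⟩

theorem IsTest.const_smul {ψ : E d → ℝ} (hψ : IsTest K ψ) (c : ℝ) : IsTest K (c • ψ) :=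
  ⟨hψ.1.const_smul c, hψ.2.1.smul_left (f := fun _ => c),
    (tsupport_smul_subset_right (fun _ => c) ψ).trans hψ.2.2⟩

theorem IsTest.gradient_add {ψ η : E d → ℝ} (hψ : IsTest K ψ) (hη : IsTest K η) :
    gradient (ψ + η) = gradient ψ + gradient η := by
  ext1 x
  simp only [gradient, Pi.add_apply, ← map_add]
  rw [fderiv_add (hψ.contDiff_one.differentiable one_ne_zero x)
    (hη.contDiff_one.differentiable one_ne_zero x)]

theorem IsTest.gradient_const_smul {ψ : E d → ℝ} (hψ : IsTest K ψ) (c : ℝ) :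
    gradient (c • ψ) = c • gradient ψ := by
  ext1 x
  simp only [gradient, Pi.smul_apply, ← map_smul]
  rw [fderiv_const_smul (hψ.contDiff_one.differentiable one_ne_zero x)]

theorem IsTest.memLp_inner_gradient {η : E d → ℝ} (hη : IsTest K η) (v : E d) :
    MemLp (fun x => inner ℝ v (gradient η x)) 2 (volume.restrict K) :=
  hη.memLp_gradient.const_inner v

theorem IsTest.memLp_smul_const {η : E d → ℝ} (hη : IsTest K η) (v : E d) :
    MemLp (fun x => η x • v) 2 (volume.restrict K) :=
  (((hη.1.continuous.smul continuous_const).memLp_of_hasCompactSupport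
    hη.2.1.smul_right).restrict K)

/-- The weak gradient relation tested in each direction `v`, written with `L²` inner products. -/
theorem isWeakGrad_iff {u : L2 K} {G : L2Vec K} :
    IsWeakGrad K u G ↔ ∀ (η : E d → ℝ) (hη : IsTest K η) (v : E d),
      inner ℝ ((hη.memLp_inner_gradient v).toLp _) u =
        - inner ℝ ((hη.memLp_smul_const v).toLp _) G := by
  unfold IsWeakGrad
  refine forall_congr' fun η => forall_congr' fun hη => ?_
  have h1 : Integrable (fun x => u x • gradient η x) (volume.restrict K) :=
    memLp_one_iff_integrable.1 (hη.memLp_gradient.smul (Lp.memLp u))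
  have h2 : Integrable (fun x => η x • G x) (volume.restrict K) :=
    memLp_one_iff_integrable.1 ((Lp.memLp G).smul hη.memLp)
  have e1 : ∀ v, inner ℝ v (∫ x in K, u x • gradient η x) =
      inner ℝ ((hη.memLp_inner_gradient v).toLp _) u := by
    intro v
    rw [← integral_inner h1, L2.inner_def]
    refine integral_congr_ae ?_
    filter_upwards [(hη.memLp_inner_gradient v).coeFn_toLp] with x hx
    rw [hx, real_inner_smul_right]
    rfl
  have e2 : ∀ v, inner ℝ v (∫ x in K, η x • G x) =
      inner ℝ ((hη.memLp_smul_const v).toLp _) G := by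
    intro v
    rw [← integral_inner h2, L2.inner_def]
    refine integral_congr_ae ?_
    filter_upwards [(hη.memLp_smul_const v).coeFn_toLp] with x hx
    rw [hx, real_inner_smul_right, real_inner_smul_left]
  constructor
  · intro h v
    rw [← e1, ← e2, h, inner_neg_right]
  · intro h
    refine ext_inner_left ℝ fun v => ?_
    rw [inner_neg_right, e1, e2, h]

theorem isClosed_setOf_isWeakGrad :
    IsClosed {x : WithLp 2 (L2 K × L2Vec K) | IsWeakGrad K x.fst x.snd} := by
  simp only [isWeakGrad_iff, Set.ofPred_forall]
  refine isClosed_iInter fun η => isClosed_iInter fun hη => isClosed_iInter fun v => ?_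
  have h1 := WithLp.prod_continuous_ofLp 2 (L2 K) (L2Vec K)
  exact isClosed_eq (continuous_const.inner (continuous_fst.comp h1))
    (continuous_const.inner (continuous_snd.comp h1)).neg

/-- A test function has its classical gradient as weak gradient. -/
theorem IsTest.isWeakGrad {ψ : E d → ℝ} (hψ : IsTest K ψ) {u : L2 K}
    {G : L2Vec K} (hu : u =ᵐ[volume.restrict K] ψ) (hG : G =ᵐ[volume.restrict K] gradient ψ) :
    IsWeakGrad K u G := by
  rw [isWeakGrad_iff]
  intro η hη v
  have hc : Continuous ψ := hψ.1.continuous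
  have hc' : Continuous η := hη.1.continuous
  have hd : Continuous (fun x => fderiv ℝ ψ x v) :=
    (hψ.contDiff_one.continuous_fderiv one_ne_zero).clm_apply continuous_const
  have hd' : Continuous (fun x => fderiv ℝ η x v) :=
    (hη.contDiff_one.continuous_fderiv one_ne_zero).clm_apply continuous_const
  have hparts := integral_mul_fderiv_eq_neg_fderiv_mul_of_integrable (μ := volume) (v := v)
    (f := ψ) (g := η)
    ((hd.mul hc').integrable_of_hasCompactSupport hη.2.1.mul_left)
    ((hc.mul hd').integrable_of_hasCompactSupport hψ.2.1.mul_right)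
    ((hc.mul hc').integrable_of_hasCompactSupport hψ.2.1.mul_right)
    (fun x _ => hψ.contDiff_one.differentiable one_ne_zero x)
    (fun x _ => hη.contDiff_one.differentiable one_ne_zero x)
  rw [L2.inner_def, L2.inner_def]
  have e1 : ∫ x in K, inner ℝ ((hη.memLp_inner_gradient v).toLp _ x) (u x) =
      ∫ x, ψ x * fderiv ℝ η x v := by
    rw [← setIntegral_eq_integral_of_forall_compl_eq_zero (s := K)
      (f := fun x => ψ x * fderiv ℝ η x v)
      fun x hx => by rw [hψ.eq_zero_of_notMem hx, zero_mul]]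
    refine integral_congr_ae ?_
    filter_upwards [(hη.memLp_inner_gradient v).coeFn_toLp, hu] with x h1 h2
    rw [h1, h2, ← inner_gradient_left, real_inner_comm v]
    rfl
  have e2 : ∫ x in K, inner ℝ ((hη.memLp_smul_const v).toLp _ x) (G x) =
      ∫ x, fderiv ℝ ψ x v * η x := by
    rw [← setIntegral_eq_integral_of_forall_compl_eq_zero (s := K)
      (f := fun x => fderiv ℝ ψ x v * η x)
      fun x hx => by rw [hη.eq_zero_of_notMem hx, mul_zero]]
    refine integral_congr_ae ?_
    filter_upwards [(hη.memLp_smul_const v).coeFn_toLp, hG] with x h1 h2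
    rw [h1, h2, ← inner_gradient_left, real_inner_smul_left, real_inner_comm v, mul_comm]
  rw [e1, e2, hparts]

theorem ae_eq_zero_of_integral_test_smul_eq_zero (hKo : IsOpen K) {F : Type*}
    [NormedAddCommGroup F] [NormedSpace ℝ F] [CompleteSpace F] {f : E d → F}
    (hf : MemLp f 2 (volume.restrict K))
    (h : ∀ ψ, IsTest K ψ → ∫ x in K, ψ x • f x = 0) : f =ᵐ[volume.restrict K] 0 := by
  have hloc : LocallyIntegrableOn f K volume := by
    refine (locallyIntegrableOn_of_locallyIntegrable_restrict ?_)
    exact hf.locallyIntegrable (by norm_num)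
  have := hKo.ae_eq_zero_of_integral_contDiff_smul_eq_zero hloc fun g h1 h2 h3 => by
    rw [← h g ⟨h1, h2, h3⟩]
    exact (setIntegral_eq_integral_of_forall_compl_eq_zero fun x hx => by
      rw [IsTest.eq_zero_of_notMem (K := K) ⟨h1, h2, h3⟩ hx, zero_smul]).symm
  rw [EventuallyEq, ae_restrict_iff' hKo.measurableSet]
  exact this

theorem IsWeakGrad.unique (hKo : IsOpen K) {u : L2 K} {G G' : L2Vec K}
    (h : IsWeakGrad K u G) (h' : IsWeakGrad K u G') : G = G' := by
  rw [← sub_eq_zero]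
  apply Lp.ext
  refine (ae_eq_zero_of_integral_test_smul_eq_zero hKo (Lp.memLp (G - G')) fun ψ hψ => ?_).trans
    (Lp.coeFn_zero _ _ _).symm
  have hi : ∀ G : L2Vec K, Integrable (fun x => ψ x • G x) (volume.restrict K) := fun G =>
    memLp_one_iff_integrable.1 ((Lp.memLp G).smul hψ.memLp)
  have : ∫ x in K, ψ x • (G - G' : L2Vec K) x = ∫ x in K, (ψ x • G x - ψ x • G' x) := by
    refine integral_congr_ae ?_
    filter_upwards [Lp.coeFn_sub G G'] with x hx
    rw [hx, Pi.sub_apply, smul_sub]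
  rw [this, integral_sub (hi G) (hi G'), sub_eq_zero, ← neg_inj, ← h ψ hψ, ← h' ψ hψ]

theorem IsWeakGrad.weakGrad_eq (hKo : IsOpen K) {u : L2 K} {G : L2Vec K}
    (h : IsWeakGrad K u G) : weakGrad K u = G := by
  have hu : MemH1 K u := ⟨G, h⟩
  rw [weakGrad, dif_pos hu]
  exact hu.choose_spec.unique hKo h

theorem MemH1.isWeakGrad {u : L2 K} (h : MemH1 K u) : IsWeakGrad K u (weakGrad K u) := by
  rw [weakGrad, dif_pos h]
  exact h.choose_spec

/-! ### `H¹₀(K)` as a closed subspace of `L²(K) × L²(K; ℝ^d)` -/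

/-- The pairs `(ψ, ∇ψ)` with `ψ` a test function, as a subspace of `L²(K) × L²(K; ℝ^d)`. -/
noncomputable def testGraph (K : Set (E d)) : Submodule ℝ (WithLp 2 (L2 K × L2Vec K)) where
  carrier := {x | ∃ ψ, IsTest K ψ ∧ x.fst =ᵐ[volume.restrict K] ψ ∧
    x.snd =ᵐ[volume.restrict K] gradient ψ}
  zero_mem' := by
    refine ⟨0, isTest_zero, Lp.coeFn_zero _ _ _, (Lp.coeFn_zero _ _ _).trans ?_⟩
    refine Eventually.of_forall fun x => ?_
    simp [gradient]
  add_mem' := by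
    rintro x y ⟨ψ, hψ, h1, h2⟩ ⟨η, hη, h3, h4⟩
    refine ⟨ψ + η, hψ.add hη, (Lp.coeFn_add _ _).trans (h1.add h3), ?_⟩
    rw [hψ.gradient_add hη]
    exact (Lp.coeFn_add _ _).trans (h2.add h4)
  smul_mem' := by
    rintro c x ⟨ψ, hψ, h1, h2⟩
    refine ⟨c • ψ, hψ.const_smul c, (Lp.coeFn_smul _ _).trans (h1.const_smul c), ?_⟩
    rw [hψ.gradient_const_smul]
    exact (Lp.coeFn_smul _ _).trans (h2.const_smul c)

/-- `H¹₀(K)`, realised as the closed subspace of pairs `(u, ∇u)` in `L²(K) × L²(K; ℝ^d)`. -/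
noncomputable def graphH10 (K : Set (E d)) : Submodule ℝ (WithLp 2 (L2 K × L2Vec K)) :=
  (testGraph K).topologicalClosure

/-- The closed subspace `graphH10 K` is the graph of the weak gradient on `H¹₀(K)`. This uses that
limits of weak gradients are weak gradients and that weak gradients are unique. -/
theorem mem_graphH10_iff (hKo : IsOpen K) (x : WithLp 2 (L2 K × L2Vec K)) :
    x ∈ graphH10 K ↔ MemH10 K x.fst ∧ weakGrad K x.fst = x.snd := by
  have hofLp := WithLp.prod_continuous_ofLp 2 (L2 K) (L2Vec K)
  have hsub : ∀ {F : Type} [NormedAddCommGroup F] (f : Lp F 2 (volume.restrict K)) (g : E d → F),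
      eLpNorm (fun y => f y - g y) 2 (volume.restrict K) =
        eLpNorm (fun y => g y - f y) 2 (volume.restrict K) := fun f g =>
    eLpNorm_sub_comm _ _ _ _
  constructor
  · intro hx
    have hwg : IsWeakGrad K x.fst x.snd := by
      refine closure_minimal ?_ isClosed_setOf_isWeakGrad hx
      rintro y ⟨ψ, hψ, h1, h2⟩
      exact hψ.isWeakGrad h1 h2
    have hgrad := hwg.weakGrad_eq hKo
    obtain ⟨y, hy, hlim⟩ := mem_closure_iff_seq_limit.1 hx
    choose ψ hψ h1 h2 using hy
    refine ⟨⟨⟨_, hwg⟩, ψ, hψ, ?_, ?_⟩, hgrad⟩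
    · have := (Lp.tendsto_Lp_iff_tendsto_eLpNorm' _ _).1
        ((continuous_fst.comp hofLp).tendsto x |>.comp hlim)
      refine this.congr fun n => ?_
      rw [hsub]
      refine eLpNorm_congr_ae ?_
      filter_upwards [h1 n] with z hz
      exact congrArg (· - _) hz
    · rw [hgrad]
      have := (Lp.tendsto_Lp_iff_tendsto_eLpNorm' _ _).1
        ((continuous_snd.comp hofLp).tendsto x |>.comp hlim)
      refine this.congr fun n => ?_
      rw [hsub]
      refine eLpNorm_congr_ae ?_
      filter_upwards [h2 n] with z hz
      exact congrArg (· - _) hz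
  · rintro ⟨⟨_, ψ, hψ, h1, h2⟩, hgrad⟩
    rw [hgrad] at h2
    refine mem_closure_iff_seq_limit.2
      ⟨fun n => WithLp.toLp 2 ((hψ n).memLp.toLp _, (hψ n).memLp_gradient.toLp _),
        fun n => ⟨ψ n, hψ n, (hψ n).memLp.coeFn_toLp, (hψ n).memLp_gradient.coeFn_toLp⟩, ?_⟩
    refine ((WithLp.prod_continuous_toLp 2 (L2 K) (L2Vec K)).tendsto (x.fst, x.snd)).comp
      (Tendsto.prodMk_nhds ?_ ?_)
    · rw [Lp.tendsto_Lp_iff_tendsto_eLpNorm']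
      refine h1.congr fun n => ?_
      rw [hsub]
      refine eLpNorm_congr_ae ?_
      filter_upwards [(hψ n).memLp.coeFn_toLp] with z hz
      exact congrArg (· - _) hz.symm
    · rw [Lp.tendsto_Lp_iff_tendsto_eLpNorm']
      refine h2.congr fun n => ?_
      rw [hsub]
      refine eLpNorm_congr_ae ?_
      filter_upwards [(hψ n).memLp_gradient.coeFn_toLp] with z hz
      exact congrArg (· - _) hz.symm

/-- **Rellich's theorem**, in the form that the embedding of `H¹₀(K)` into `L²(K)` is a norm limit
of compact operators. -/
theorem exists_isCompactOperator_norm_sub_le_of_mem_graphH10 (hK : MeasurableSet K)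
    (hKb : Bornology.IsBounded K) {ε : ℝ} (hε : 0 < ε) :
    ∃ P : L2 K →L[ℝ] L2 K, IsCompactOperator P ∧
      ∀ x ∈ graphH10 K, ‖x.fst - P x.fst‖ ≤ ε * ‖x.snd‖ := by
  obtain ⟨P, hP, hest⟩ := exists_isCompactOperator_norm_sub_le hK hKb hε
  refine ⟨P, hP, fun x hx => ?_⟩
  have hofLp := WithLp.prod_continuous_ofLp 2 (L2 K) (L2Vec K)
  have h1 : Continuous fun x : WithLp 2 (L2 K × L2Vec K) => x.fst := continuous_fst.comp hofLp
  have h2 : Continuous fun x : WithLp 2 (L2 K × L2Vec K) => x.snd := continuous_snd.comp hofLp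
  have hcl : IsClosed {x : WithLp 2 (L2 K × L2Vec K) | ‖x.fst - P x.fst‖ ≤ ε * ‖x.snd‖} :=
    isClosed_le (h1.sub (P.continuous.comp h1)).norm (continuous_const.mul h2.norm)
  refine closure_minimal ?_ hcl hx
  rintro y ⟨ψ, hψ, hy1, hy2⟩
  exact hest ψ _ _ hψ hy1 hy2

/-! ### The weighted energy space -/

section Weighted

variable {a b : E d → ℝ} (ha : MemLp a ⊤ (volume.restrict K))
  (hb : MemLp b ⊤ (volume.restrict K))

/-- The pairs `(a u, a ∇u)` with `u ∈ H¹₀(K)`, where `a = b⁻¹`. It is written as the set of those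
`x` for which `b x` lies in `graphH10 K`, so that it is visibly closed. For `a = √κ` its inner
product is `m^K + a^K`. -/
noncomputable def weightedH10 : Submodule ℝ (WithLp 2 (L2 K × L2Vec K)) :=
  (graphH10 K).comap ((WithLp.prodContinuousLinearEquiv 2 ℝ (L2 K) (L2Vec K)).symm ∘L
    ((mulOp ℝ hb).prodMap (mulOp (E d) hb)) ∘L
    (WithLp.prodContinuousLinearEquiv 2 ℝ (L2 K) (L2Vec K)).toContinuousLinearMap).toLinearMap

theorem isClosed_weightedH10 : IsClosed (weightedH10 hb : Set (WithLp 2 (L2 K × L2Vec K))) :=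
  (testGraph K).isClosed_topologicalClosure.preimage (ContinuousLinearMap.continuous _)

instance completeSpace_weightedH10 : CompleteSpace (weightedH10 hb) :=
  (isClosed_weightedH10 hb).completeSpace_coe

theorem mem_weightedH10_iff (hKo : IsOpen K) (x : WithLp 2 (L2 K × L2Vec K)) :
    x ∈ weightedH10 hb ↔ MemH10 K (mulOp ℝ hb x.fst) ∧
      weakGrad K (mulOp ℝ hb x.fst) = mulOp (E d) hb x.snd :=
  mem_graphH10_iff hKo _

/-- The embedding `(a u, a ∇u) ↦ a u` of the weighted energy space into `L²(K)`. -/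
noncomputable def weightedEmbed : weightedH10 hb →L[ℝ] L2 K :=
  WithLp.fstL 2 ℝ (L2 K) (L2Vec K) ∘L (weightedH10 hb).subtypeL

theorem weightedEmbed_apply (z : weightedH10 hb) :
    weightedEmbed hb z = (z : WithLp 2 (L2 K × L2Vec K)).fst := rfl

variable (hab : ∀ᵐ x ∂volume.restrict K, a x * b x = 1)
include ha hab

/-- The point `(a u, a ∇u)` of the weighted energy space attached to `u ∈ H¹₀(K)`. -/
theorem mulOp_mem_weightedH10 (hKo : IsOpen K) {u : L2 K} (hu : MemH10 K u) :
    WithLp.toLp 2 (mulOp ℝ ha u, mulOp (E d) ha (weakGrad K u)) ∈ weightedH10 hb := by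
  have hba : ∀ᵐ x ∂volume.restrict K, b x * a x = 1 := hab.mono fun x hx => by rwa [mul_comm]
  rw [mem_weightedH10_iff hb hKo]
  simp only [WithLp.toLp_fst, WithLp.toLp_snd, mulOp_mulOp_of_mul_eq_one hb ha hba]
  exact ⟨hu, trivial⟩

/-- Conjugating by the multiplications by `a` and `b = a⁻¹` transports the compact approximations of
the unweighted embedding to the weighted one. -/
theorem isCompactOperator_weightedEmbed (hKo : IsOpen K) (hKb : Bornology.IsBounded K) :
    IsCompactOperator (weightedEmbed hb) := by
  refine isCompactOperator_of_forall_exists_norm_sub_le fun ε hε => ?_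
  set C : ℝ := ‖mulOp ℝ ha‖ * ‖mulOp (E d) hb‖
  have hC : 0 ≤ C := by positivity
  obtain ⟨P, hP, hest⟩ := exists_isCompactOperator_norm_sub_le_of_mem_graphH10
    hKo.measurableSet hKb (show 0 < ε / (C + 1) by positivity)
  refine ⟨mulOp ℝ ha ∘L P ∘L mulOp ℝ hb ∘L weightedEmbed hb,
    (hP.comp_clm (mulOp ℝ hb ∘L weightedEmbed hb)).clm_comp (mulOp ℝ ha), fun z => ?_⟩
  let x : WithLp 2 (L2 K × L2Vec K) := z.1
  have hx := hest _ (show _ ∈ graphH10 K from z.2)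
  calc ‖weightedEmbed hb z - (mulOp ℝ ha ∘L P ∘L mulOp ℝ hb ∘L weightedEmbed hb) z‖
      = ‖mulOp ℝ ha (mulOp ℝ hb x.fst - P (mulOp ℝ hb x.fst))‖ := by
        rw [map_sub, mulOp_mulOp_of_mul_eq_one ha hb hab]
        rfl
    _ ≤ ‖mulOp ℝ ha‖ * (ε / (C + 1) * ‖mulOp (E d) hb x.snd‖) :=
        ((mulOp ℝ ha).le_opNorm _).trans (by gcongr; exact hx)
    _ ≤ ‖mulOp ℝ ha‖ * (ε / (C + 1) * (‖mulOp (E d) hb‖ * ‖z‖)) := by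
        gcongr
        refine ((mulOp (E d) hb).le_opNorm _).trans ?_
        gcongr
        exact WithLp.norm_snd_le _ x
    _ = C * (ε / (C + 1)) * ‖z‖ := by ring
    _ ≤ ε * ‖z‖ := by
        gcongr
        rw [mul_div_assoc', div_le_iff₀ (by positivity)]
        nlinarith

/-- The range of the embedding is dense, because it contains `a ψ` for every test function `ψ`. -/
theorem eq_zero_of_inner_weightedEmbed_eq_zero (hKo : IsOpen K) {f : L2 K}
    (hf : ∀ z, inner ℝ f (weightedEmbed hb z) = 0) : f = 0 := by
  have hba : ∀ᵐ x ∂volume.restrict K, b x * a x = 1 := hab.mono fun x hx => by rwa [mul_comm]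
  have h0 : mulOp ℝ ha f = 0 := by
    apply Lp.ext
    refine (ae_eq_zero_of_integral_test_smul_eq_zero hKo (Lp.memLp _) fun ψ hψ => ?_).trans
      (Lp.coeFn_zero _ _ _).symm
    have hmem : WithLp.toLp 2 (hψ.memLp.toLp ψ, hψ.memLp_gradient.toLp (gradient ψ)) ∈
        graphH10 K :=
      (testGraph K).le_topologicalClosure
        ⟨ψ, hψ, hψ.memLp.coeFn_toLp, hψ.memLp_gradient.coeFn_toLp⟩
    have hz := hf ⟨_, mulOp_mem_weightedH10 ha hb hab hKo ((mem_graphH10_iff hKo _).1 hmem).1⟩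
    rw [weightedEmbed_apply, L2.inner_def] at hz
    rw [← hz]
    refine integral_congr_ae ?_
    filter_upwards [coeFn_mulOp ha f, coeFn_mulOp ha (hψ.memLp.toLp ψ), hψ.memLp.coeFn_toLp]
      with x h1 h2 h3
    simp only [WithLp.toLp_fst, h1, h2, h3, smul_eq_mul, RCLike.inner_apply, conj_trivial]
    ring
  rw [← mulOp_mulOp_of_mul_eq_one hb ha hba f, h0, map_zero]

end Weighted

/-! ### The bilinear forms in the weighted spaces -/

section Forms

variable {a b κ : E d → ℝ} (ha : MemLp a ⊤ (volume.restrict K))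
  (hb : MemLp b ⊤ (volume.restrict K)) (hκ : ∀ᵐ x ∂volume.restrict K, a x * a x = κ x)
include hκ

theorem inner_mulOp_eq_massForm (u v : L2 K) :
    inner ℝ (mulOp ℝ ha u) (mulOp ℝ ha v) = massForm K κ u v := by
  rw [inner_mulOp_mulOp ha hκ, massForm]
  refine integral_congr_ae (Eventually.of_forall fun x => ?_)
  simp only [RCLike.inner_apply, conj_trivial]
  ring

theorem inner_mulOp_weakGrad_eq_energyForm (u v : L2 K) :
    inner ℝ (mulOp (E d) ha (weakGrad K u)) (mulOp (E d) ha (weakGrad K v)) =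
      energyForm K κ u v :=
  inner_mulOp_mulOp ha hκ _ _

variable (hab : ∀ᵐ x ∂volume.restrict K, a x * b x = 1)
include hab hb

/-- If `J† f` has first component `a u`, then `u ∈ H¹₀(K)` solves
`a^K(u, v) + m^K(u, v) = ⟪f, a v⟫` for all `v ∈ H¹₀(K)`. -/
theorem memH10_and_energyForm_of_weightedEmbed_adjoint (hKo : IsOpen K) {f : L2 K} {u : L2 K}
    (h : weightedEmbed hb ((weightedEmbed hb).adjoint f) = mulOp ℝ ha u) :
    MemH10 K u ∧ ∀ v, MemH10 K v →
      massForm K κ u v + energyForm K κ u v = inner ℝ f (mulOp ℝ ha v) := by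
  have hba : ∀ᵐ x ∂volume.restrict K, b x * a x = 1 := hab.mono fun x hx => by rwa [mul_comm]
  set z := (weightedEmbed hb).adjoint f with hz
  rw [weightedEmbed_apply] at h
  obtain ⟨h1, h2⟩ := (mem_weightedH10_iff hb hKo _).1 z.2
  rw [h, mulOp_mulOp_of_mul_eq_one hb ha hba] at h1 h2
  have hsnd : (z : WithLp 2 (L2 K × L2Vec K)).snd = mulOp (E d) ha (weakGrad K u) := by
    rw [h2, mulOp_mulOp_of_mul_eq_one ha hb hab]
  refine ⟨h1, fun v hv => ?_⟩
  have hadj := (weightedEmbed hb).adjoint_inner_left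
    ⟨_, mulOp_mem_weightedH10 ha hb hab hKo hv⟩ f
  rw [weightedEmbed_apply, ← hz, Submodule.coe_inner, WithLp.prod_inner_apply] at hadj
  simp only [WithLp.ofLp_fst, WithLp.ofLp_snd, WithLp.toLp_fst, h, hsnd] at hadj
  rw [← hadj, ← inner_mulOp_eq_massForm ha hκ, ← inner_mulOp_weakGrad_eq_energyForm ha hκ]

/-- Conversely, a solution `u ∈ H¹₀(K)` of that problem has `a u = J J† f`. -/
theorem weightedEmbed_adjoint_eq_of_energyForm (hKo : IsOpen K) {f : L2 K} {u : L2 K}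
    (hu : MemH10 K u) (h : ∀ v, MemH10 K v →
      massForm K κ u v + energyForm K κ u v = inner ℝ f (mulOp ℝ ha v)) :
    weightedEmbed hb ((weightedEmbed hb).adjoint f) = mulOp ℝ ha u := by
  suffices hz : (weightedEmbed hb).adjoint f = ⟨_, mulOp_mem_weightedH10 ha hb hab hKo hu⟩ by
    rw [hz]; rfl
  refine ext_inner_right ℝ fun z => ?_
  obtain ⟨h1, h2⟩ := (mem_weightedH10_iff hb hKo _).1 z.2
  have h3 := h _ h1
  rw [← inner_mulOp_eq_massForm ha hκ, ← inner_mulOp_weakGrad_eq_energyForm ha hκ, h2,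
    mulOp_mulOp_of_mul_eq_one ha hb hab, mulOp_mulOp_of_mul_eq_one ha hb hab] at h3
  rw [ContinuousLinearMap.adjoint_inner_left, weightedEmbed_apply, ← h3, Submodule.coe_inner,
    WithLp.prod_inner_apply]
  rfl

/-! ### The Dirichlet eigenfunctions -/

/-- The eigenfunctions of the Dirichlet problem are complete in `L²(K)`. -/
theorem IsEigensystem.orthogonal_span_eq_bot (hKo : IsOpen K) (hKb : Bornology.IsBounded K)
    {μ : ℕ → ℝ} {φ : ℕ → L2 K} (hsys : IsEigensystem K κ μ φ) :
    (Submodule.span ℝ (Set.range fun l => mulOp ℝ ha (φ l)))ᗮ = ⊥ := by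
  refine orthogonal_eq_bot_of_eigenvectors_mem (weightedEmbed hb)
    (isCompactOperator_weightedEmbed ha hb hab hKo hKb)
    (fun f hf => eq_zero_of_inner_weightedEmbed_eq_zero ha hb hab hKo hf) _ ?_
  intro f r hf hr hfr
  set ψ := mulOp ℝ hb f with hψ
  have hfψ : mulOp ℝ ha ψ = f := mulOp_mulOp_of_mul_eq_one ha hb hab f
  have hpre : weightedEmbed hb ((weightedEmbed hb).adjoint (r⁻¹ • f)) = mulOp ℝ ha ψ := by
    rw [map_smul, map_smul, hfr, smul_smul, inv_mul_cancel₀ hr, one_smul, hfψ]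
  obtain ⟨h1, h2⟩ := memH10_and_energyForm_of_weightedEmbed_adjoint ha hb hκ hab hKo hpre
  -- an eigenvalue `r` of `J J†` belongs to the Dirichlet eigenvalue `r⁻¹ - 1`
  have heig : IsEigenpair K κ (r⁻¹ - 1) ψ := by
    refine ⟨?_, h1, fun v hv => ?_⟩
    · intro h0
      rw [h0, map_zero] at hfψ
      exact hf hfψ.symm
    · have h3 := h2 v hv
      rw [real_inner_smul_left, ← hfψ, inner_mulOp_eq_massForm ha hκ] at h3
      linarith
  have hspan := Submodule.mem_map_of_mem (f := (mulOp ℝ ha).toLinearMap)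
    (Submodule.span_mono (Set.image_subset_range _ _) (hsys.exhaustive _ _ heig))
  rw [Submodule.map_span, ← Set.range_comp] at hspan
  rw [← hfψ]
  exact hspan

/-- A Dirichlet eigenfunction `φ` with eigenvalue `μ` gives an eigenvector `a φ` of `J J†` with
eigenvalue `(μ + 1)⁻¹`. -/
theorem IsEigensystem.smul_weightedEmbed_adjoint (hKo : IsOpen K)
    {μ : ℕ → ℝ} {φ : ℕ → L2 K} (hsys : IsEigensystem K κ μ φ) (l : ℕ) :
    (μ l + 1) • weightedEmbed hb ((weightedEmbed hb).adjoint (mulOp ℝ ha (φ l))) =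
      mulOp ℝ ha (φ l) := by
  rw [← map_smul, ← map_smul]
  refine weightedEmbed_adjoint_eq_of_energyForm ha hb hκ hab hKo (hsys.eigenpair l).2.1 ?_
  intro v hv
  rw [(hsys.eigenpair l).2.2 v hv, real_inner_smul_left, inner_mulOp_eq_massForm ha hκ]
  ring

end Forms

/-! ### The square root of the coefficient -/

theorem memLp_top_sqrt {α : Type*} {mα : MeasurableSpace α} {ν : Measure α} {κ : α → ℝ}
    (hκ : MemLp κ ⊤ ν) : MemLp (fun x => √(κ x)) ⊤ ν := by
  refine memLp_top_of_bound (Real.continuous_sqrt.comp_aestronglyMeasurable hκ.1)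
    √(eLpNormEssSup κ ν).toReal ?_
  have hlt : eLpNormEssSup κ ν < ⊤ := by simpa using hκ.2
  filter_upwards [enorm_ae_le_eLpNormEssSup κ ν] with x hx
  rw [Real.norm_of_nonneg (Real.sqrt_nonneg _)]
  refine Real.sqrt_le_sqrt ((le_abs_self _).trans ?_)
  rw [← Real.norm_eq_abs, ← toReal_enorm]
  exact ENNReal.toReal_mono hlt.ne hx

theorem memLp_top_inv_sqrt {α : Type*} {mα : MeasurableSpace α} {ν : Measure α} {κ : α → ℝ}
    (hκ : AEStronglyMeasurable κ ν) {c₀ : ℝ} (hc₀ : 0 < c₀) (hκc : ∀ᵐ x ∂ν, c₀ ≤ κ x) :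
    MemLp (fun x => (√(κ x))⁻¹) ⊤ ν := by
  refine memLp_top_of_bound
    (Real.continuous_sqrt.comp_aestronglyMeasurable hκ).aemeasurable.inv.aestronglyMeasurable
    (√c₀)⁻¹ ?_
  filter_upwards [hκc] with x hx
  rw [Real.norm_of_nonneg (by positivity)]
  gcongr

/-! ### The divergence of the flux -/

/-- If `a^K(u, v) = m^K(g, v)` for all `v ∈ H¹₀(K)`, then `-κ g` is the distributional divergence
of `κ ∇u`. -/
theorem isWeakDiv_of_energyForm_eq_massForm (hKo : IsOpen K) {κ : E d → ℝ}
    (hκ : MemLp κ ⊤ (volume.restrict K)) {u g : L2 K}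
    (h : ∀ v, MemH10 K v → energyForm K κ u v = massForm K κ g v) :
    IsWeakDiv K (fun x => κ x • weakGrad K u x) (fun x => -(κ x * g x)) := by
  refine ⟨locallyIntegrableOn_of_locallyIntegrable_restrict ?_, fun ψ hψ => ?_⟩
  · have hmem : MemLp (fun x => κ x * g x) 2 (volume.restrict K) := (Lp.memLp g).mul hκ
    exact hmem.neg.locallyIntegrable (by norm_num)
  · have hmem : WithLp.toLp 2 (hψ.memLp.toLp ψ, hψ.memLp_gradient.toLp (gradient ψ)) ∈
        graphH10 K :=
      (testGraph K).le_topologicalClosure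
        ⟨ψ, hψ, hψ.memLp.coeFn_toLp, hψ.memLp_gradient.coeFn_toLp⟩
    obtain ⟨h1, h2⟩ := (mem_graphH10_iff hKo _).1 hmem
    simp only [WithLp.toLp_fst, WithLp.toLp_snd] at h1 h2
    have h3 := h _ h1
    rw [energyForm, massForm, h2] at h3
    have e1 : ∫ x in K, inner ℝ (κ x • weakGrad K u x) (gradient ψ x) =
        ∫ x in K, κ x * inner ℝ (weakGrad K u x)
          (hψ.memLp_gradient.toLp (gradient ψ) x) := by
      refine integral_congr_ae ?_
      filter_upwards [hψ.memLp_gradient.coeFn_toLp] with x hx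
      rw [hx, real_inner_smul_left]
    rw [e1, h3, ← integral_neg]
    refine integral_congr_ae ?_
    filter_upwards [hψ.memLp.coeFn_toLp] with x hx
    rw [hx]
    ring

theorem lintegral_ofReal_mul_sq_eq {a κ : E d → ℝ} (ha : MemLp a ⊤ (volume.restrict K))
    (hκ : ∀ᵐ x ∂volume.restrict K, a x * a x = κ x) (g : L2 K) :
    ∫⁻ x in K, ENNReal.ofReal (κ x * g x * g x) = ENNReal.ofReal (massForm K κ g g) := by
  have hae : (fun x => inner ℝ (mulOp ℝ ha g x) (mulOp ℝ ha g x)) =ᵐ[volume.restrict K]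
      fun x => κ x * g x * g x := by
    filter_upwards [coeFn_mulOp ha g, hκ] with x h1 h2
    rw [h1, ← h2]
    simp only [smul_eq_mul, RCLike.inner_apply, conj_trivial]
    ring
  rw [massForm, ofReal_integral_eq_lintegral_ofReal]
  · exact (L2.integrable_inner (𝕜 := ℝ) (mulOp ℝ ha g) (mulOp ℝ ha g)).congr hae
  · filter_upwards [hae] with x hx
    rw [← hx]
    exact real_inner_self_nonneg

end DirichletBlock

/-! ### The operator `A^K` -/

open DirichletBlock

theorem mainTheorem5 {d : ℕ} (K : Set (DirichletBlock.E d)) (hKo : IsOpen K)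
    (hKb : Bornology.IsBounded K)
    (κ : DirichletBlock.E d → ℝ) (hκ : MemLp κ ⊤ (volume.restrict K))
    (c₀ : ℝ) (hc₀ : 0 < c₀) (hκc : ∀ᵐ x ∂(volume.restrict K), c₀ ≤ κ x)
    (μ : ℕ → ℝ) (φ : ℕ → DirichletBlock.L2 K)
    (hsys : DirichletBlock.IsEigensystem K κ μ φ)
    (u : DirichletBlock.L2 K) (hu : DirichletBlock.eigNormSq K κ μ φ 2 u < ⊤) :
    DirichletBlock.MemH10 K u ∧
    ∃ (w : DirichletBlock.E d → ℝ) (Au : DirichletBlock.L2 K),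
      -- `w = div(κ ∇u)` and `κ⁻¹ w ∈ L²(K)`
      DirichletBlock.IsWeakDiv K (fun x => κ x • DirichletBlock.weakGrad K u x) w ∧
      MemLp (fun x => (κ x)⁻¹ * w x) 2 (volume.restrict K) ∧
      -- `Au` is the sum of the series defining `A^K u`, and it equals `-κ⁻¹ div(κ ∇u)`
      HasSum (DirichletBlock.opTerm K κ μ φ u) Au ∧
      (∀ᵐ x ∂(volume.restrict K), Au x = -((κ x)⁻¹ * w x)) ∧
      -- integration by parts
      (∀ v : DirichletBlock.L2 K, DirichletBlock.MemH10 K v →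
        DirichletBlock.energyForm K κ u v = - ∫ x in K, w x * v x) ∧
      -- the norm identities
      DirichletBlock.eigNormSq K κ μ φ 2 u
        = ENNReal.ofReal (DirichletBlock.massForm K κ Au Au) ∧
      DirichletBlock.eigNormSq K κ μ φ 2 u
        = ∫⁻ x in K, ENNReal.ofReal ((κ x)⁻¹ * |w x| ^ 2) := by
  have ha := memLp_top_sqrt hκ
  have hb := memLp_top_inv_sqrt hκ.1 hc₀ hκc
  have haa : ∀ᵐ x ∂volume.restrict K, √(κ x) * √(κ x) = κ x := by
    filter_upwards [hκc] with x hx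
    exact Real.mul_self_sqrt (hc₀.le.trans hx)
  have hab : ∀ᵐ x ∂volume.restrict K, √(κ x) * (√(κ x))⁻¹ = 1 := by
    filter_upwards [hκc] with x hx
    exact mul_inv_cancel₀ (Real.sqrt_pos.2 (hc₀.trans_le hx)).ne'
  have hba : ∀ᵐ x ∂volume.restrict K, (√(κ x))⁻¹ * √(κ x) = 1 :=
    hab.mono fun x hx => by rwa [mul_comm]
  set A := mulOp ℝ ha with hA
  set e : ℕ → L2 K := fun l => A (φ l) with he_def
  have he : Orthonormal ℝ e := by
    rw [orthonormal_iff_ite]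
    intro k l
    rw [← hsys.orthonormal k l]
    exact inner_mulOp_eq_massForm ha haa _ _
  have hc : ∀ l, inner ℝ (e l) (A u) = massForm K κ u (φ l) := fun l => by
    rw [real_inner_comm]
    exact inner_mulOp_eq_massForm ha haa _ _
  have hterm : eigNormSq K κ μ φ 2 u =
      ∑' l, ENNReal.ofReal ((μ l * inner ℝ (e l) (A u)) ^ 2) := by
    rw [eigNormSq]
    refine tsum_congr fun l => ?_
    rw [hc, mul_pow, Real.rpow_ofNat]
  have hsummable : Summable fun l => (μ l * inner ℝ (e l) (A u)) ^ 2 := by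
    have h := ENNReal.summable_toReal (hterm ▸ hu).ne
    simpa only [ENNReal.toReal_ofReal (sq_nonneg _)] using h
  obtain ⟨W, hW, hWn, hWU⟩ := exists_hasSum_of_summable_eigenvalue_sq (weightedEmbed hb) he
    (hsys.orthogonal_span_eq_bot ha hb haa hab hKo hKb)
    (hsys.smul_weightedEmbed_adjoint ha hb haa hab hKo) hsummable
  obtain ⟨hu10, hform⟩ :=
    memH10_and_energyForm_of_weightedEmbed_adjoint ha hb haa hab hKo hWU
  set Au : L2 K := mulOp ℝ hb W with hAu
  have hAAu : A Au = W := mulOp_mulOp_of_mul_eq_one ha hb hab W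
  have henergy : ∀ v, MemH10 K v → energyForm K κ u v = massForm K κ Au v := fun v hv => by
    have h := hform v hv
    rw [inner_add_left, ← hAAu, inner_mulOp_eq_massForm ha haa,
      inner_mulOp_eq_massForm ha haa] at h
    linarith
  have hcancel : ∀ᵐ x ∂volume.restrict K, (κ x)⁻¹ * -(κ x * Au x) = -Au x := by
    filter_upwards [hκc] with x hx
    have : κ x ≠ 0 := (hc₀.trans_le hx).ne'
    field_simp
  have hnorm : eigNormSq K κ μ φ 2 u = ENNReal.ofReal (massForm K κ Au Au) := by
    rw [hterm, ← ENNReal.ofReal_tsum_of_nonneg (fun _ => sq_nonneg _) hsummable, hWn.tsum_eq,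
      ← inner_mulOp_eq_massForm ha haa, ← hA, hAAu, real_inner_self_eq_norm_sq]
  refine ⟨hu10, fun x => -(κ x * Au x), Au, isWeakDiv_of_energyForm_eq_massForm hKo hκ henergy,
    ?_, ?_, ?_, ?_, hnorm, ?_⟩
  · exact (Lp.memLp Au).neg.ae_eq (hcancel.mono fun x hx => hx.symm)
  · have h := (mulOp ℝ hb).hasSum hW
    convert! h using 2 with l
    rw [opTerm, map_smul, he_def, hc, hA, mulOp_mulOp_of_mul_eq_one hb ha hba]
  · filter_upwards [hcancel] with x hx
    rw [hx, neg_neg]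
  · intro v hv
    rw [henergy v hv, massForm, ← integral_neg]
    refine integral_congr_ae (Eventually.of_forall fun x => ?_)
    ring
  · rw [hnorm, ← lintegral_ofReal_mul_sq_eq ha haa Au]
    refine lintegral_congr_ae ?_
    filter_upwards [hκc] with x hx
    have : κ x ≠ 0 := (hc₀.trans_le hx).ne'
    rw [sq_abs]
    congr 1
    field_simp
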